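/- For integers $p,q$ let $\mathrm{BS}(p,q)=\langle a,t\mid ta^pt^{-1}=a^q\rangle$ denote the Baumslag–Solitar group. Regard $\mathrm{GL}(2,\mathbb{Z})$ as a subgroup of $\mathrm{GL}(2,\mathbb{Q})$, and let $G$ be a finitely generated group with $\mathrm{GL}(2,\mathbb{Z})\lneq G\leq \mathrm{GL}(2,\mathbb{Q})$. Then exactly one of the following two cases holds. 1. $G$ is isomorphic to $\mathrm{GL}(2,\mathbb{Z})\times\mathbb{Z}^k$ for some $k\geq 1$, and $G$ contains no subgroup isomorphic to $\mathrm{BS}(1,q)$ for any $q\geq 2$. 2. For some $q\geq 2$ there are subgroups $B\leq K\leq G$ such that $B$ is isomorphic to $\mathrm{BS}(1,q)$ and $B$ has infinite index in $K$. Moreover, if $G$ is isomorphic to $\mathrm{GL}(2,\mathbb{Z})\times\mathbb{Z}^k$ for some $k\geq 1$, then $G$ contains no subgroup isomorphic to $\mathrm{BS}(1,q)$ with $q\geq 2$; so the isomorphism in case 1 alone already excludes case 2. -/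

import Mathlib

/-- The single defining relator `t a^p t⁻¹ (a^q)⁻¹` of the Baumslag-Solitar group, in the free
group on two letters, with `a` the letter `0` and `t` the letter `1`. -/
def baumslagSolitarRelator (p q : ℤ) : FreeGroup (Fin 2) :=
  FreeGroup.of 1 * FreeGroup.of 0 ^ p * (FreeGroup.of 1)⁻¹ * (FreeGroup.of 0 ^ q)⁻¹

/-- The Baumslag-Solitar group `BS(p, q) = ⟨a, t | t a^p t⁻¹ = a^q⟩`. -/
abbrev BaumslagSolitar (p q : ℤ) : Type :=
  PresentedGroup ({baumslagSolitarRelator p q} : Set (FreeGroup (Fin 2)))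

/-- `GL(2, ℤ)` as a subgroup of `GL(2, ℚ)`: the matrices with integral entries whose inverse also
has integral entries. -/
def integralGL2 : Subgroup (Matrix.GeneralLinearGroup (Fin 2) ℚ) :=
  (Matrix.GeneralLinearGroup.map (n := Fin 2) (Int.castRingHom ℚ)).range

/-- `G` is isomorphic to `GL(2, ℤ) × ℤ^k` for some `k ≥ 1`. -/
def IsGL2ZTimesFreeAbelian (G : Subgroup (Matrix.GeneralLinearGroup (Fin 2) ℚ)) : Prop :=
  ∃ k : ℕ, 1 ≤ k ∧
    Nonempty (G ≃* Matrix.GeneralLinearGroup (Fin 2) ℤ × Multiplicative (Fin k → ℤ))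

/-- `G` contains a subgroup isomorphic to `BS(1, q)` for some `q ≥ 2`. -/
def ContainsBS (G : Subgroup (Matrix.GeneralLinearGroup (Fin 2) ℚ)) : Prop :=
  ∃ q : ℕ, 2 ≤ q ∧ ∃ B : Subgroup (Matrix.GeneralLinearGroup (Fin 2) ℚ),
    B ≤ G ∧ Nonempty (BaumslagSolitar 1 q ≃* B)

/-- `G` contains a subgroup `K` which is an extension (that is, an overgroup) of infinite index of
a copy `B` of `BS(1, q)`, for some `q ≥ 2`. -/
def ContainsInfiniteIndexExtensionOfBS
    (G : Subgroup (Matrix.GeneralLinearGroup (Fin 2) ℚ)) : Prop :=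
  ∃ q : ℕ, 2 ≤ q ∧ ∃ K B : Subgroup (Matrix.GeneralLinearGroup (Fin 2) ℚ),
    B ≤ K ∧ K ≤ G ∧ Nonempty (BaumslagSolitar 1 q ≃* B) ∧ ¬ B.IsFiniteRelIndex K

/-! ### Normal forms in `BS(1, q)` -/

/-! The dichotomy is whether every element of `G` is a rational scalar times an element of `GL(2,
ℤ)`. If so, `G` is the direct product of `GL(2, ℤ)` and the group of positive scalars in `G`. The
latter is finitely generated and torsion-free abelian, hence free, and nontrivial because `G` is
strictly larger than `GL(2, ℤ)`. If not, clearing denominators and Smith normal form give a diagonal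
matrix in `G` whose entries have ratio `b` with `|b| ≥ 2`. The inverse of its square and the
elementary matrix `!![1, 1; 0, 1]` generate a copy of `BS(1, b²)`
(`BaumslagSolitar.lift_injective`). This copy is upper triangular, so it contains no positive power
of `!![1, 0; 1, 1]` and has infinite index in `G`. The cases exclude each other: if `t a t⁻¹ = a ^
q` in `GL(2, ℤ) × ℤ^k`, then `a ^ 24 = 1` (`pow_twentyFour_eq_one_of_conj_eq_pow`), while `a` has
infinite order in `BS(1, q)`. -/

lemma BaumslagSolitar.relation (q : ℕ) :
    (PresentedGroup.of 1 * PresentedGroup.of 0 * (PresentedGroup.of 1)⁻¹ :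
      BaumslagSolitar 1 q) = PresentedGroup.of 0 ^ q := by
  have h := PresentedGroup.one_of_mem (Set.mem_singleton (baumslagSolitarRelator 1 q))
  rw [← mul_inv_eq_one]
  refine Eq.trans ?_ h
  change _ = PresentedGroup.mk _ (FreeGroup.of 1 * FreeGroup.of 0 ^ (1 : ℤ) *
    (FreeGroup.of 1)⁻¹ * (FreeGroup.of 0 ^ (q : ℤ))⁻¹)
  simp only [map_mul, map_inv, zpow_one, zpow_natCast]
  rfl

lemma pow_mul_eq_pow_mul_of_conj {H : Type*} [Group H] {a t : H} {q : ℕ}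
    (h : t * a * t⁻¹ = a ^ q) (i : ℕ) : t ^ i * a = a ^ q ^ i * t ^ i := by
  induction i with
  | zero => simp
  | succ i ih =>
    have hn (n : ℕ) : t * a ^ n = a ^ (q * n) * t := by
      rw [pow_mul, ← h, conj_pow]; group
    rw [pow_succ', mul_assoc, ih, ← mul_assoc, hn, pow_succ' q, mul_assoc]

/-- Every element of `BS(1, q)` has the form `t⁻ⁱ aᵏ tʲ`. -/
lemma BaumslagSolitar.exists_normal_form (q : ℕ) (x : BaumslagSolitar 1 q) :
    ∃ (i j : ℕ) (k : ℤ), PresentedGroup.of 1 ^ i * x =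
      PresentedGroup.of 0 ^ k * PresentedGroup.of 1 ^ j := by
  have hx : x ∈ Subgroup.closure (Set.range (PresentedGroup.of (rels :=
      ({baumslagSolitarRelator 1 q} : Set (FreeGroup (Fin 2)))))) := by
    rw [PresentedGroup.closure_range_of]; trivial
  have hr := pow_mul_eq_pow_mul_of_conj (BaumslagSolitar.relation q)
  induction hx using Subgroup.closure_induction_left with
  | one => exact ⟨0, 0, 0, by simp⟩
  | mul_left s hs y hy ih =>
    obtain ⟨i, j, k, ih⟩ := ih
    obtain ⟨s, rfl⟩ := hs
    fin_cases s
    · refine ⟨i, j, (q ^ i : ℕ) + k, ?_⟩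
      rw [zpow_add, zpow_natCast, mul_assoc, ← ih, ← mul_assoc, ← mul_assoc]
      exact congrArg (· * y) (hr i)
    · refine ⟨i, j + 1, q * k, ?_⟩
      have h1 : (PresentedGroup.of 1 * PresentedGroup.of 0 ^ k : BaumslagSolitar 1 q) =
          PresentedGroup.of 0 ^ (q * k) * PresentedGroup.of 1 := by
        rw [zpow_mul, zpow_natCast, ← BaumslagSolitar.relation, conj_zpow]; group
      rw [pow_succ', ← mul_assoc (_ ^ (_ : ℤ)), ← h1, mul_assoc, ← ih, ← mul_assoc, ← mul_assoc]
      exact congrArg (· * y) (pow_mul_comm' _ _)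
  | inv_mul_cancel s hs y hy ih =>
    obtain ⟨i, j, k, ih⟩ := ih
    obtain ⟨s, rfl⟩ := hs
    fin_cases s
    · refine ⟨i, j, -(q ^ i : ℕ) + k, ?_⟩
      rw [zpow_add, zpow_neg, zpow_natCast, mul_assoc, ← ih, ← mul_assoc, ← mul_assoc]
      refine congrArg (· * y) ?_
      rw [eq_inv_mul_iff_mul_eq, ← mul_assoc, mul_inv_eq_iff_eq_mul]
      exact (hr i).symm
    · exact ⟨i + 1, j, k, by rw [← ih, pow_succ]; simp [mul_assoc]⟩

/-- A homomorphism out of `BS(1, q)` given by images of the generators. -/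
def BaumslagSolitar.lift {H : Type*} [Group H] {q : ℕ} (a t : H) (h : t * a * t⁻¹ = a ^ q) :
    BaumslagSolitar 1 q →* H :=
  PresentedGroup.toGroup (f := ![a, t]) (by
    rintro r rfl
    simp [baumslagSolitarRelator, h])

@[simp] lemma BaumslagSolitar.lift_of_zero {H : Type*} [Group H] {q : ℕ} (a t : H)
    (h : t * a * t⁻¹ = a ^ q) :
    BaumslagSolitar.lift a t h (PresentedGroup.of 0) = a :=
  PresentedGroup.toGroup.of _

@[simp] lemma BaumslagSolitar.lift_of_one {H : Type*} [Group H] {q : ℕ} (a t : H)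
    (h : t * a * t⁻¹ = a ^ q) :
    BaumslagSolitar.lift a t h (PresentedGroup.of 1) = t :=
  PresentedGroup.toGroup.of _

section

open Matrix

/-! ### Copies of `BS(1, q)` in `GL(2, ℚ)` -/

lemma upperRightHom_one_zpow (k : ℤ) :
    ((GeneralLinearGroup.upperRightHom (1 : ℚ) ^ k : GL (Fin 2) ℚ) : Matrix (Fin 2) (Fin 2) ℚ) =
      !![1, (k : ℚ); 0, 1] := by
  rw [← AddChar.map_zsmul_eq_zpow]
  simp

lemma coe_pow_of_eq_diagonal {T : GL (Fin 2) ℚ} {x y : ℚ} (hT : T.val = !![x, 0; 0, y]) (i : ℕ) :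
    (T ^ i).val = !![x ^ i, 0; 0, y ^ i] := by
  induction i with
  | zero => simp [one_fin_two]
  | succ i ih =>
    rw [pow_succ, Units.val_mul, ih, hT]
    simp [pow_succ]

lemma conj_upperRightHom_one {T : GL (Fin 2) ℚ} {q : ℕ} {x y : ℚ}
    (hT : T.val = !![x, 0; 0, y]) (hxy : x = q * y) :
    T * GeneralLinearGroup.upperRightHom (1 : ℚ) * T⁻¹ =
      GeneralLinearGroup.upperRightHom (1 : ℚ) ^ q := by
  rw [mul_inv_eq_iff_eq_mul, ← zpow_natCast]
  ext1
  rw [Units.val_mul, Units.val_mul, upperRightHom_one_zpow, hT]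
  simp [hxy]

lemma ne_zero_of_eq_diagonal {T : GL (Fin 2) ℚ} {x y : ℚ} (hT : T.val = !![x, 0; 0, y]) :
    x ≠ 0 ∧ y ≠ 0 := by
  have h := T.det.ne_zero
  simpa [hT, det_fin_two] using h

/-- On a normal form in the kernel, the matrix entries give `k = 0`, `y ^ i = y ^ j` and `x ^ i = x
^ j`; as `x = q y`, this forces `q ^ i = q ^ j`. -/
lemma BaumslagSolitar.lift_injective {T : GL (Fin 2) ℚ} {q : ℕ} (hq : 2 ≤ q) {x y : ℚ}
    (hT : T.val = !![x, 0; 0, y]) (hxy : x = q * y) :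
    Function.Injective (BaumslagSolitar.lift (GeneralLinearGroup.upperRightHom (1 : ℚ)) T
      (conj_upperRightHom_one hT hxy)) := by
  obtain ⟨-, hy⟩ := ne_zero_of_eq_diagonal hT
  rw [injective_iff_map_eq_one]
  intro g hg
  obtain ⟨i, j, k, hn⟩ := BaumslagSolitar.exists_normal_form q g
  have h1 := congrArg (fun g => (BaumslagSolitar.lift (GeneralLinearGroup.upperRightHom (1 : ℚ)) T
      (conj_upperRightHom_one hT hxy) g).val) hn
  simp only [map_mul, map_pow, map_zpow, hg, lift_of_zero, lift_of_one, mul_one] at h1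
  rw [Units.val_mul, upperRightHom_one_zpow, coe_pow_of_eq_diagonal hT,
    coe_pow_of_eq_diagonal hT] at h1
  have h00 := congrFun (congrFun h1 0) 0
  have h01 := congrFun (congrFun h1 0) 1
  have h11 := congrFun (congrFun h1 1) 1
  simp [hy] at h00 h01 h11
  have hk : k = 0 := h01
  have hij : i = j := by
    rw [hxy, mul_pow, mul_pow, h11] at h00
    have := mul_right_cancel₀ (pow_ne_zero j hy) h00
    exact Nat.pow_right_injective hq (by exact_mod_cast this)
  subst hk hij
  simpa using hn

lemma BaumslagSolitar.lift_lower_left_eq_zero {T : GL (Fin 2) ℚ} {q : ℕ} {x y : ℚ}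
    (hT : T.val = !![x, 0; 0, y]) (hxy : x = q * y) (g : BaumslagSolitar 1 q) :
    (BaumslagSolitar.lift (GeneralLinearGroup.upperRightHom (1 : ℚ)) T
      (conj_upperRightHom_one hT hxy) g).val 1 0 = 0 := by
  obtain ⟨-, hy⟩ := ne_zero_of_eq_diagonal hT
  obtain ⟨i, j, k, hn⟩ := BaumslagSolitar.exists_normal_form q g
  have h1 := congrArg (fun g => (BaumslagSolitar.lift (GeneralLinearGroup.upperRightHom (1 : ℚ)) T
      (conj_upperRightHom_one hT hxy) g).val) hn
  simp only [map_mul, map_pow, map_zpow, lift_of_zero, lift_of_one, Units.val_mul] at h1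
  rw [upperRightHom_one_zpow, coe_pow_of_eq_diagonal hT, coe_pow_of_eq_diagonal hT] at h1
  have h10 := congrFun (congrFun h1 1) 0
  simpa [mul_apply, Fin.sum_univ_two, hy] using h10

/-- In `BS(1, q)` with `q ≥ 2` the generator `a` has infinite order. -/
lemma BaumslagSolitar.of_zero_pow_ne_one {q : ℕ} (hq : 2 ≤ q) {n : ℕ} (hn : n ≠ 0) :
    (PresentedGroup.of 0 : BaumslagSolitar 1 q) ^ n ≠ 1 := by
  intro h
  have hq0 : (q : ℚ) ≠ 0 := by positivity
  have hT : (GeneralLinearGroup.mkOfDetNeZero !![(q : ℚ), 0; 0, 1] (by simp; omega)).val =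
      !![(q : ℚ), 0; 0, 1] := rfl
  have h1 := congrArg (fun g => (BaumslagSolitar.lift (GeneralLinearGroup.upperRightHom (1 : ℚ)) _
      (conj_upperRightHom_one (q := q) hT (by simp)) g).val) h
  simp only [map_pow, lift_of_zero, map_one] at h1
  rw [← zpow_natCast, upperRightHom_one_zpow] at h1
  have h01 := congrFun (congrFun h1 0) 1
  simp [hn] at h01

/-! ### Integral matrices -/

lemma mem_integralGL2_of_map_eq {g : GL (Fin 2) ℚ} {M : Matrix (Fin 2) (Fin 2) ℤ}
    (hM : IsUnit M.det) (h : M.map (Int.cast : ℤ → ℚ) = g.val) : g ∈ integralGL2 := by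
  refine ⟨GeneralLinearGroup.mk'' M hM, ?_⟩
  ext1
  exact h

/-- If `G` contains the integral matrices together with a diagonal matrix of ratio `q`, then it
contains a copy of `BS(1, q)` of infinite index. -/
lemma containsInfiniteIndexExtensionOfBS_of_diagonal_mem {G : Subgroup (GL (Fin 2) ℚ)}
    (hG : integralGL2 ≤ G) {T : GL (Fin 2) ℚ} (hTG : T ∈ G) {q : ℕ} (hq : 2 ≤ q) {x y : ℚ}
    (hT : T.val = !![x, 0; 0, y]) (hxy : x = q * y) : ContainsInfiniteIndexExtensionOfBS G := by
  set φ := BaumslagSolitar.lift (GeneralLinearGroup.upperRightHom (1 : ℚ)) T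
      (conj_upperRightHom_one hT hxy) with hφ
  have hA : GeneralLinearGroup.upperRightHom (1 : ℚ) ∈ G := by
    refine hG (mem_integralGL2_of_map_eq (M := !![1, 1; 0, 1]) (by simp) ?_)
    ext i j; fin_cases i <;> fin_cases j <;> simp
  refine ⟨q, hq, G, φ.range, ?_, le_rfl,
    ⟨MonoidHom.ofInjective (BaumslagSolitar.lift_injective hq hT hxy)⟩, fun hfin => ?_⟩
  · have : (⊤ : Subgroup (BaumslagSolitar 1 q)) ≤ G.comap φ := by
      rw [← PresentedGroup.closure_range_of, Subgroup.closure_le]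
      rintro _ ⟨s, rfl⟩
      fin_cases s
      · simpa [hφ] using hA
      · simpa [hφ] using hTG
    rintro _ ⟨g, rfl⟩
    exact this trivial
  · let L : GL (Fin 2) ℚ := GeneralLinearGroup.mkOfDetNeZero !![1, 0; 1, 1] (by simp)
    have hL : L ∈ G := by
      refine hG (mem_integralGL2_of_map_eq (M := !![1, 0; 1, 1]) (by simp) ?_)
      ext i j; fin_cases i <;> fin_cases j <;> simp [L]
    have hpow (n : ℕ) : (L ^ n).val = !![1, 0; (n : ℚ), 1] := by
      induction n with
      | zero => simp [one_fin_two]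
      | succ n ih =>
        rw [pow_succ, Units.val_mul, ih]
        simp [L]
    -- Finite index would put some `L ^ n` with `n > 0` into the upper triangular image, but its
    -- lower left entry is `n`.
    obtain ⟨n, hn, -, ⟨g, hg⟩, -⟩ := Subgroup.exists_pow_mem_of_relIndex_ne_zero hfin.1 hL
    have h10 := BaumslagSolitar.lift_lower_left_eq_zero hT hxy g
    rw [← hφ, hg, hpow] at h10
    simp at h10
    omega

/-! ### `GL(2, ℤ) × ℤ^k` contains no copy of `BS(1, q)` -/

lemma Matrix.pow_add_two_of_det_eq_one {b : Matrix (Fin 2) (Fin 2) ℤ} (hb : b.det = 1) (n : ℕ) :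
    b ^ (n + 2) = b.trace • b ^ (n + 1) - b ^ n := by
  have h : b ^ 2 = b.trace • b - 1 := by
    rw [det_fin_two] at hb
    ext i j
    fin_cases i <;> fin_cases j <;>
      simp [sq, mul_apply, Fin.sum_univ_two, trace_fin_two, -zsmul_eq_mul] <;> linarith
  rw [pow_add, h, pow_succ, mul_sub, mul_smul_comm, mul_one]

/-- By Cayley–Hamilton the traces satisfy `τₙ₊₂ = τ τₙ₊₁ - τₙ`, so `|τₙ₊₂| ≥ 3|τₙ₊₁| - |τₙ|`; the
induction starts from `τ₀ = 2`. -/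
lemma Matrix.abs_trace_pow_lt {b : Matrix (Fin 2) (Fin 2) ℤ} (hb : b.det = 1)
    (h : 3 ≤ |b.trace|) (n : ℕ) : |(b ^ n).trace| < |(b ^ (n + 1)).trace| := by
  induction n with
  | zero => simp; omega
  | succ n ih =>
    have h1 : (b ^ (n + 2)).trace = b.trace * (b ^ (n + 1)).trace - (b ^ n).trace := by
      rw [pow_add_two_of_det_eq_one hb, trace_sub, trace_smul, smul_eq_mul]
    have h2 := abs_sub_abs_le_abs_sub (b.trace * (b ^ (n + 1)).trace) (b ^ n).trace
    rw [← h1, abs_mul] at h2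
    nlinarith [abs_nonneg (b ^ (n + 1)).trace]

lemma one_add_pow_of_mul_self_eq_zero {R : Type*} [Ring R] {N : R} (hN : N * N = 0) (n : ℕ) :
    (1 + N) ^ n = 1 + n • N := by
  induction n with
  | zero => simp
  | succ n ih =>
    rw [pow_succ, ih, add_mul, mul_add, mul_add, smul_mul_assoc, smul_mul_assoc, hN, succ_nsmul]
    simp only [mul_one, one_mul, smul_zero, add_zero]
    abel

/-- An integral matrix that is conjugate over `ℤ` to a proper multiple of itself vanishes. -/
lemma Matrix.eq_zero_of_conj_eq_nsmul {q : ℕ} (hq : 2 ≤ q) (t : GL (Fin 2) ℤ)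
    {N : Matrix (Fin 2) (Fin 2) ℤ} (h : t.val * N * (t⁻¹).val = q • N) : N = 0 := by
  have hstep (X : Matrix (Fin 2) (Fin 2) ℤ) (m : ℕ) (hX : N = m • X) :
      N = (q * m) • ((t⁻¹).val * X * t.val) := by
    have h1 : (t⁻¹).val * (t.val * N * (t⁻¹).val) * t.val = N := by
      simp [mul_assoc]
    rw [← h1, h, hX, mul_smul_comm, mul_smul_comm, smul_mul_assoc, smul_mul_assoc, smul_smul]
  -- Iterating the relation makes `N` divisible by every power of `q`.
  have hdvd (n : ℕ) : ∃ X : Matrix (Fin 2) (Fin 2) ℤ, N = (q ^ n) • X := by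
    induction n with
    | zero => exact ⟨N, by simp⟩
    | succ n ih =>
      obtain ⟨X, hX⟩ := ih
      exact ⟨_, by rw [pow_succ']; exact hstep X _ hX⟩
  ext i j
  obtain ⟨X, hX⟩ := hdvd (N i j).natAbs
  refine Int.eq_zero_of_abs_lt_dvd (m := (q : ℤ) ^ (N i j).natAbs) ⟨X i j, ?_⟩ ?_
  · conv_lhs => rw [hX]
    simp
  · rw [Int.abs_eq_natAbs]
    exact_mod_cast Nat.lt_pow_self (by omega)

/-- The square `b = a²` has determinant 1 and is conjugate to `b ^ q`, so trace growth leaves only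
`|tr b| ≤ 2`. Traces `-1, 0, 1` give `b³ = 1`, `b² = -1`, `b³ = -1`; for traces `±2`, `b²` is
unipotent and must be 1. In every case `b ^ 12 = 1`. -/
lemma pow_twentyFour_eq_one_of_conj_eq_pow {q : ℕ} (hq : 2 ≤ q) {a t : GL (Fin 2) ℤ}
    (h : t * a * t⁻¹ = a ^ q) : a ^ 24 = 1 := by
  set b : Matrix (Fin 2) (Fin 2) ℤ := a.val ^ 2 with hb
  have hconj (n : ℕ) : t.val * a.val ^ n * (t⁻¹).val = (a.val ^ n) ^ q := by
    have h1 : t * a ^ n * t⁻¹ = (a ^ n) ^ q := by rw [← conj_pow, h, pow_right_comm]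
    simpa using congrArg Units.val h1
  have hdet : b.det = 1 := by
    rw [hb, det_pow]
    rcases Int.isUnit_iff.mp ((isUnit_iff_isUnit_det _).mp a.isUnit) with h | h <;> simp [h]
  have hrec := pow_add_two_of_det_eq_one hdet
  have htr : |b.trace| < 3 := by
    by_contra! hlt
    have h1 : (b ^ q).trace = b.trace := by
      rw [hb, ← hconj, trace_units_conj]
    have hmono := strictMono_nat_of_lt_succ (Matrix.abs_trace_pow_lt hdet hlt)
    have h2 := hmono (show 1 < q by omega)
    simp [h1] at h2
  suffices hb12 : b ^ 12 = 1 by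
    ext1
    rw [Units.val_pow_eq_pow_val, show 24 = 2 * 12 from rfl, pow_mul, ← hb, hb12, Units.val_one]
  have hsq : b ^ 2 = b.trace • b - 1 := by simpa using hrec 0
  -- With `b² = 1 + N` and `N² = 0`, conjugation by `t` sends `N` to `q N`, so `N = 0`.
  have hunip (hN : (b ^ 2 - 1) * (b ^ 2 - 1) = 0) : b ^ 12 = 1 := by
    have h1 : b ^ 2 - 1 = 0 := by
      refine eq_zero_of_conj_eq_nsmul hq t ?_
      have h2 := one_add_pow_of_mul_self_eq_zero hN q
      have h3 := hconj 4
      rw [show 4 = 2 * 2 from rfl, pow_mul, ← hb, ← add_sub_cancel 1 (b ^ 2), h2] at h3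
      rw [add_sub_cancel] at h3
      rw [mul_sub, sub_mul, h3, mul_one, Units.mul_inv, add_sub_cancel_left]
    rw [show 12 = 2 * 6 from rfl, pow_mul, sub_eq_zero.mp h1, one_pow]
  obtain ⟨hl, hu⟩ := abs_lt.mp htr
  have hcube : b ^ 3 = b.trace • b ^ 2 - b := by simpa using hrec 1
  generalize b.trace = τ at *
  interval_cases τ
  · refine hunip ?_
    have : ((-2 : ℤ) • b - 1 - 1) * ((-2 : ℤ) • b - 1 - 1) =
        (4 : ℤ) • (b ^ 2 - ((-2 : ℤ) • b - 1)) := by noncomm_ring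
    rw [hsq, this, hsq, sub_self, smul_zero]
  · have : b ^ 3 = 1 := by rw [hcube, hsq]; simp
    rw [show 12 = 3 * 4 from rfl, pow_mul, this, one_pow]
  · have : b ^ 2 = -1 := by rw [hsq]; simp
    rw [show 12 = 2 * 6 from rfl, pow_mul, this]; simp [Even.neg_pow (by decide : Even 6)]
  · have : b ^ 3 = -1 := by rw [hcube, hsq]; simp
    rw [show 12 = 3 * 4 from rfl, pow_mul, this]; simp [Even.neg_pow (by decide : Even 4)]
  · refine hunip ?_
    have : ((2 : ℤ) • b - 1 - 1) * ((2 : ℤ) • b - 1 - 1) =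
        (4 : ℤ) • (b ^ 2 - ((2 : ℤ) • b - 1)) := by noncomm_ring
    rw [hsq, this, hsq, sub_self, smul_zero]

lemma not_containsBS_of_isGL2ZTimesFreeAbelian {G : Subgroup (GL (Fin 2) ℚ)}
    (h : IsGL2ZTimesFreeAbelian G) : ¬ ContainsBS G := by
  obtain ⟨k, -, ⟨e⟩⟩ := h
  rintro ⟨q, hq, B, hBG, ⟨f⟩⟩
  let φ : BaumslagSolitar 1 q →* GL (Fin 2) ℤ × Multiplicative (Fin k → ℤ) :=
    e.toMonoidHom.comp ((Subgroup.inclusion hBG).comp f.toMonoidHom)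
  have hφ : Function.Injective φ :=
    e.injective.comp ((Subgroup.inclusion_injective hBG).comp f.injective)
  have hrel := congrArg φ (BaumslagSolitar.relation q)
  simp only [map_mul, map_inv, map_pow] at hrel
  have h1 := pow_twentyFour_eq_one_of_conj_eq_pow hq (congrArg Prod.fst hrel)
  have h2 : (φ (PresentedGroup.of 0)).2 = 1 := by
    have h3 := congrArg Prod.snd hrel
    simp only [Prod.snd_mul, Prod.snd_inv, Prod.pow_snd, mul_inv_cancel_comm] at h3
    obtain ⟨r, rfl⟩ : ∃ r, q = r + 1 := ⟨q - 1, by omega⟩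
    rw [pow_succ, right_eq_mul] at h3
    exact (pow_eq_one_iff_left (by omega)).mp h3
  refine BaumslagSolitar.of_zero_pow_ne_one hq (n := 24) (by norm_num) (hφ ?_)
  rw [map_pow, map_one]
  exact Prod.ext h1 (by simp [h2])

/-! ### Diagonalisation of integral `2 × 2` matrices -/

/-- A column operation and a swap bring the remainder of `N 0 1` modulo `N 0 0` into the corner, so
by minimality it vanishes. -/
lemma Matrix.dvd_of_minimal_left {N : Matrix (Fin 2) (Fin 2) ℤ}
    (hmin : ∀ u v : Matrix (Fin 2) (Fin 2) ℤ, IsUnit u.det → IsUnit v.det →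
      (u * N * v) 0 0 ≠ 0 → (N 0 0).natAbs ≤ ((u * N * v) 0 0).natAbs) (h0 : N 0 0 ≠ 0) :
    N 0 0 ∣ N 0 1 := by
  by_contra hnd
  have h := hmin 1 !![-(N 0 1 / N 0 0), 1; 1, 0] (by simp) (by simp)
  have h1 : (1 * N * !![-(N 0 1 / N 0 0), 1; 1, 0] : Matrix (Fin 2) (Fin 2) ℤ) 0 0 = N 0 1 % N 0 0 := by
    rw [Int.emod_def]
    simp only [one_mul, mul_apply, Fin.sum_univ_two]
    simp
    ring
  rw [h1] at h
  have h2 := h (fun h => hnd (Int.dvd_of_emod_eq_zero h))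
  have h3 := Int.emod_lt_abs (N 0 1) h0
  rw [Int.abs_eq_natAbs] at h3
  have h4 := Int.emod_nonneg (N 0 1) h0
  omega

/-- Every nonzero integral `2 × 2` matrix is equivalent to a diagonal matrix `diag(a, a b)`. -/
lemma Matrix.exists_smith_normal_form_fin_two {M : Matrix (Fin 2) (Fin 2) ℤ} (hM : M ≠ 0) :
    ∃ u v : Matrix (Fin 2) (Fin 2) ℤ, IsUnit u.det ∧ IsUnit v.det ∧
      ∃ a b : ℤ, a ≠ 0 ∧ u * M * v = !![a, 0; 0, a * b] := by
  classical
  -- The pivot is a nonzero corner entry of least absolute value among all matrices equivalent to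
  -- `M`.
  let P : ℕ → Prop := fun n => n ≠ 0 ∧ ∃ u v : Matrix (Fin 2) (Fin 2) ℤ,
    IsUnit u.det ∧ IsUnit v.det ∧ ((u * M * v) 0 0).natAbs = n
  have hP : ∃ n, P n := by
    have hex : ∃ i j, M i j ≠ 0 := by
      by_contra! hc
      exact hM (by ext i j; simpa using hc i j)
    obtain ⟨i, j, hij⟩ := hex
    have hw : IsUnit (!![0, 1; 1, 0] : Matrix (Fin 2) (Fin 2) ℤ).det := by simp
    refine ⟨(M i j).natAbs, by simpa using hij, ?_⟩
    fin_cases i <;> fin_cases j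
    · exact ⟨1, 1, by simp, by simp, by simp⟩
    · exact ⟨1, _, by simp, hw, by simp [mul_apply, Fin.sum_univ_two]⟩
    · exact ⟨_, 1, hw, by simp, by simp [mul_apply, vecMul, dotProduct, Fin.sum_univ_two]⟩
    · exact ⟨_, _, hw, hw, by simp [mul_apply, vecMul, dotProduct, Fin.sum_univ_two]⟩
  obtain ⟨hn0, u, v, hu, hv, hn⟩ := Nat.find_spec hP
  have hmin := fun m => Nat.find_min' hP (m := m)
  rw [← hn] at hn0 hmin
  set N := u * M * v with hN
  have ha : N 0 0 ≠ 0 := by simpa using hn0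
  have hminN (r s : Matrix (Fin 2) (Fin 2) ℤ) (hr : IsUnit r.det) (hs : IsUnit s.det)
      (h : (r * N * s) 0 0 ≠ 0) : (N 0 0).natAbs ≤ ((r * N * s) 0 0).natAbs := by
    refine hmin _ ⟨by simpa using h, r * u, v * s, ?_, ?_, ?_⟩
    · rw [det_mul]; exact hr.mul hu
    · rw [det_mul]; exact hv.mul hs
    · simp only [hN, mul_assoc]
  obtain ⟨k, hk⟩ := dvd_of_minimal_left hminN ha
  obtain ⟨l, hl⟩ : N 0 0 ∣ N 1 0 := by
    refine dvd_of_minimal_left (N := Nᵀ) (fun r s hr hs h => ?_) ha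
    have hT : (r * Nᵀ * s) 0 0 = (sᵀ * N * rᵀ) 0 0 := by
      rw [← transpose_apply (r * Nᵀ * s) 0 0]
      rw [transpose_mul, transpose_mul, transpose_transpose, ← mul_assoc]
    rw [hT] at h ⊢
    exact hminN _ _ (by simpa using hs) (by simpa using hr) h
  have hdiag : !![1, 0; -l, 1] * N * !![1, -k; 0, 1] = !![N 0 0, 0; 0, N 1 1 - N 0 0 * l * k] := by
    ext i j
    simp only [mul_apply, Fin.sum_univ_two]
    fin_cases i <;> fin_cases j <;> simp [hk, hl] <;> ring
  -- Adding the second row to the first moves the other diagonal entry next to the pivot, which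
  -- stays minimal.
  obtain ⟨m, hm⟩ : N 0 0 ∣ N 1 1 - N 0 0 * l * k := by
    have h := dvd_of_minimal_left (N := !![1, 1; 0, 1] * (!![1, 0; -l, 1] * N * !![1, -k; 0, 1]))
      (fun r s hr hs h => ?_) ?_
    · rw [hdiag] at h
      simpa using h
    · have h00 : (!![1, 1; 0, 1] * (!![1, 0; -l, 1] * N * !![1, -k; 0, 1]) :
          Matrix (Fin 2) (Fin 2) ℤ) 0 0 = N 0 0 := by
        rw [hdiag]; simp
      rw [h00]
      have hassoc : r * (!![1, 1; 0, 1] * (!![1, 0; -l, 1] * N * !![1, -k; 0, 1])) * s =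
          (r * !![1, 1; 0, 1] * !![1, 0; -l, 1]) * N * (!![1, -k; 0, 1] * s) := by
        simp only [mul_assoc]
      rw [hassoc] at h ⊢
      exact hminN _ _ (by rw [det_mul, det_mul]; simpa using hr) (by rw [det_mul]; simpa using hs) h
    · rw [hdiag]; simpa using ha
  refine ⟨!![1, 0; -l, 1] * u, v * !![1, -k; 0, 1], by rw [det_mul]; simpa using hu,
    by rw [det_mul]; simpa using hv,
    N 0 0, m, ha, ?_⟩
  rw [← hm, ← hdiag, hN]
  simp only [mul_assoc]

/-! ### The dichotomy -/

lemma scalar_mul_val (c : ℚˣ) (g : GL (Fin 2) ℚ) :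
    (GeneralLinearGroup.scalar (Fin 2) c * g).val = (c : ℚ) • g.val := by
  rw [Units.val_mul]
  ext i j
  simp [GeneralLinearGroup.scalar]

lemma scalar_commute (c : ℚˣ) (g : GL (Fin 2) ℚ) :
    Commute (GeneralLinearGroup.scalar (Fin 2) c) g :=
  Units.ext (Matrix.scalar_commute (c : ℚ) (Commute.all _) g.val)

/-- Some rational multiple of a rational matrix is integral and nonzero. -/
lemma exists_map_intCast_eq_smul (g : GL (Fin 2) ℚ) :
    ∃ (β : ℤ) (M : Matrix (Fin 2) (Fin 2) ℤ), β ≠ 0 ∧ M.map (Int.cast : ℤ → ℚ) = (β : ℚ) • g.val := by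
  obtain ⟨β, hβ⟩ := IsLocalization.exist_integer_multiples_of_finite (nonZeroDivisors ℤ)
    (fun p : Fin 2 × Fin 2 => g.val p.1 p.2)
  choose f hf using hβ
  refine ⟨β, Matrix.of fun i j => f (i, j), nonZeroDivisors.coe_ne_zero β, ?_⟩
  ext i j
  have := hf (i, j)
  simpa [zsmul_eq_mul] using this

lemma containsInfiniteIndexExtensionOfBS_of_not_scalar_mul_mem {G : Subgroup (GL (Fin 2) ℚ)}
    (hG : integralGL2 ≤ G) {g : GL (Fin 2) ℚ} (hg : g ∈ G)
    (h : ∀ c : ℚˣ, GeneralLinearGroup.scalar (Fin 2) c * g ∉ integralGL2) :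
    ContainsInfiniteIndexExtensionOfBS G := by
  obtain ⟨β, M, hβ, hM⟩ := exists_map_intCast_eq_smul g
  have hβ' : (β : ℚ) ≠ 0 := by exact_mod_cast hβ
  have hM0 : M ≠ 0 := by
    rintro rfl
    have : g.val = 0 := by
      have h0 : (0 : Matrix (Fin 2) (Fin 2) ℚ) = (β : ℚ) • g.val := by simpa using hM
      exact (smul_eq_zero.mp h0.symm).resolve_left hβ'
    exact g.ne_zero this
  obtain ⟨u, v, hu, hv, a, b, ha, huv⟩ := exists_smith_normal_form_fin_two hM0
  have ha' : (a : ℚ) ≠ 0 := by exact_mod_cast ha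
  let U : GL (Fin 2) ℚ := GeneralLinearGroup.map (Int.castRingHom ℚ) (GeneralLinearGroup.mk'' u hu)
  let V : GL (Fin 2) ℚ := GeneralLinearGroup.map (Int.castRingHom ℚ) (GeneralLinearGroup.mk'' v hv)
  have hU : U ∈ integralGL2 := ⟨_, rfl⟩
  have hV : V ∈ integralGL2 := ⟨_, rfl⟩
  have hd : (β : ℚ) • (U * g * V).val = !![(a : ℚ), 0; 0, a * b] := by
    have h1 : (u * M * v).map (Int.castRingHom ℚ) = (β : ℚ) • (U * g * V).val := by
      rw [Matrix.map_mul, Matrix.map_mul]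
      change U.val * M.map (Int.cast : ℤ → ℚ) * V.val = _
      rw [hM]
      simp
    rw [← h1, huv]
    ext i j
    fin_cases i <;> fin_cases j <;> simp
  have hd' : (U * g * V).val = !![(a / β : ℚ), 0; 0, a * b / β] := by
    rw [← inv_smul_smul₀ hβ' (U * g * V).val, hd]
    ext i j
    fin_cases i <;> fin_cases j <;> simp <;> field_simp
  have hb : (b : ℚ) ≠ 0 := by
    have := (ne_zero_of_eq_diagonal hd').2
    rintro h
    simp [h] at this
  -- If `b = ±1`, rescaling by `β / a` would make `U * g * V`, hence `g`, integral and invertible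
  -- over `ℤ`.
  have hb2 : 2 ≤ b.natAbs := by
    by_contra hlt
    have hunit : IsUnit b := by
      have : b ≠ 0 := by exact_mod_cast hb
      rw [Int.isUnit_iff]; omega
    let c : ℚˣ := Units.mk0 (β / a) (div_ne_zero hβ' ha')
    refine h c ?_
    have h1 : GeneralLinearGroup.scalar (Fin 2) c * (U * g * V) ∈ integralGL2 := by
      refine mem_integralGL2_of_map_eq (M := !![1, 0; 0, b]) (by simpa using hunit) ?_
      rw [scalar_mul_val, hd']
      ext i j
      fin_cases i <;> fin_cases j <;> simp [c] <;> field_simp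
    have h2 : GeneralLinearGroup.scalar (Fin 2) c * g =
        U⁻¹ * (GeneralLinearGroup.scalar (Fin 2) c * (U * g * V)) * V⁻¹ := by
      rw [mul_assoc U, ← mul_assoc _ U, (scalar_commute c U).eq]
      simp [mul_assoc]
    rw [h2]
    exact mul_mem (mul_mem (inv_mem hU) h1) (inv_mem hV)
  -- Squaring makes the ratio positive whatever the sign of `b`; inverting puts the larger entry
  -- first, as `x = q y` requires.
  let T : GL (Fin 2) ℚ := GeneralLinearGroup.mkOfDetNeZero
    !![(β / a : ℚ) ^ 2, 0; 0, (β / (a * b) : ℚ) ^ 2] (by simp [ha', hb, hβ])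
  have hT : T = ((U * g * V) ^ 2)⁻¹ := by
    refine eq_inv_of_mul_eq_one_left ?_
    ext1
    rw [Units.val_mul, coe_pow_of_eq_diagonal hd']
    simp [T, one_fin_two]
    constructor <;> field_simp
  have hTG : T ∈ G := by
    rw [hT]
    exact inv_mem (pow_mem (mul_mem (mul_mem (hG hU) hg) (hG hV)) 2)
  refine containsInfiniteIndexExtensionOfBS_of_diagonal_mem hG hTG (q := b.natAbs ^ 2)
    (by nlinarith) (x := (β / a : ℚ) ^ 2) (y := (β / (a * b) : ℚ) ^ 2) rfl ?_
  push_cast [Nat.cast_natAbs]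
  rw [sq_abs]
  field_simp

/-! ### Positive scalars and the direct product case -/

/-- The positive scalars contained in `G`. -/
def positiveScalars (G : Subgroup (GL (Fin 2) ℚ)) : Subgroup ℚˣ :=
  G.comap (GeneralLinearGroup.scalar (Fin 2)) ⊓ Units.posSubgroup ℚ

instance (G : Subgroup (GL (Fin 2) ℚ)) : IsMulTorsionFree (positiveScalars G) where
  pow_left_injective n hn x y hxy := by
    have h := congrArg (fun z : positiveScalars G => ((z : ℚˣ) : ℚ)) hxy
    simp only [SubgroupClass.coe_pow, Units.val_pow_eq_pow_val] at h
    have hx : (0 : ℚ) < (x : ℚˣ) := x.2.2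
    have hy : (0 : ℚ) < (y : ℚˣ) := y.2.2
    exact Subtype.ext (Units.ext ((pow_left_inj₀ hx.le hy.le hn).mp h))

lemma eq_one_of_scalar_mem_integralGL2 {c : ℚˣ} (hc : (0 : ℚ) < c)
    (h : GeneralLinearGroup.scalar (Fin 2) c ∈ integralGL2) : c = 1 := by
  obtain ⟨m, hm⟩ := h
  have h1 := congrArg (fun g : GL (Fin 2) ℚ => g.val.det) hm
  have h2 : (GeneralLinearGroup.scalar (Fin 2) c).val.det = (c : ℚ) ^ 2 := by
    simp [GeneralLinearGroup.scalar]
  have h3 : (GeneralLinearGroup.map (Int.castRingHom ℚ) m).val.det = (m.val.det : ℚ) := by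
    exact (RingHom.map_det (Int.castRingHom ℚ) m.val).symm
  simp only [h2, h3] at h1
  have hsq : (c : ℚ) ^ 2 = 1 := by
    rcases Int.isUnit_iff.mp ((isUnit_iff_isUnit_det _).mp m.isUnit) with h | h
    · rw [← h1, h]; simp
    · rw [h] at h1; push_cast at h1; nlinarith
  ext
  simpa using (pow_eq_one_iff_of_nonneg hc.le two_ne_zero).mp hsq

/-- The sign of the scalar can be absorbed because `-1` lies in `GL(2, ℤ)`. -/
lemma exists_mem_positiveScalars_mul_mem {G : Subgroup (GL (Fin 2) ℚ)} (hG : integralGL2 ≤ G)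
    {g : GL (Fin 2) ℚ} (hg : g ∈ G)
    (h : ∃ c : ℚˣ, GeneralLinearGroup.scalar (Fin 2) c * g ∈ integralGL2) :
    ∃ c ∈ positiveScalars G, GeneralLinearGroup.scalar (Fin 2) c * g ∈ integralGL2 := by
  have hmem {c : ℚˣ} (hc : GeneralLinearGroup.scalar (Fin 2) c * g ∈ integralGL2) :
      GeneralLinearGroup.scalar (Fin 2) c ∈ G :=
    (G.mul_mem_cancel_right hg).mp (hG hc)
  obtain ⟨c, hc⟩ := h
  rcases lt_or_gt_of_ne c.ne_zero with hneg | hpos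
  · have h1 : GeneralLinearGroup.scalar (Fin 2) (-1) ∈ integralGL2 := by
      refine mem_integralGL2_of_map_eq (M := -1) (by simp [det_neg]) ?_
      ext i j
      fin_cases i <;> fin_cases j <;> simp [GeneralLinearGroup.scalar]
    have h2 : GeneralLinearGroup.scalar (Fin 2) (-c) * g ∈ integralGL2 := by
      rw [← neg_one_mul, map_mul, mul_assoc]
      exact mul_mem h1 hc
    exact ⟨-c, ⟨hmem h2, by simpa using hneg⟩, h2⟩
  · exact ⟨c, ⟨hmem hc, hpos⟩, hc⟩

/-- If `G` consists of scalar multiples of integral matrices, then `G ≅ GL(2, ℤ) × Λ` with `Λ` the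
group of positive scalars in `G`. -/
lemma nonempty_prod_positiveScalars_mulEquiv {G : Subgroup (GL (Fin 2) ℚ)} (hG : integralGL2 ≤ G)
    (h : ∀ g ∈ G, ∃ c : ℚˣ, GeneralLinearGroup.scalar (Fin 2) c * g ∈ integralGL2) :
    Nonempty (GL (Fin 2) ℤ × positiveScalars G ≃* G) := by
  let f : GL (Fin 2) ℤ × positiveScalars G →* GL (Fin 2) ℚ :=
    MonoidHom.noncommCoprod (GeneralLinearGroup.map (Int.castRingHom ℚ))
      ((GeneralLinearGroup.scalar (Fin 2)).comp (positiveScalars G).subtype)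
      (fun m c => (scalar_commute _ _).symm)
  have hf (m : GL (Fin 2) ℤ) (c : positiveScalars G) : f (m, c) =
      GeneralLinearGroup.map (Int.castRingHom ℚ) m * GeneralLinearGroup.scalar (Fin 2) c := rfl
  have hinj : Function.Injective f := by
    rw [injective_iff_map_eq_one]
    rintro ⟨m, c⟩ hmc
    rw [hf] at hmc
    have hc : c = 1 := by
      refine Subtype.ext (eq_one_of_scalar_mem_integralGL2 c.2.2 ?_)
      rw [eq_inv_of_mul_eq_one_right hmc]
      exact inv_mem ⟨m, rfl⟩
    subst hc
    have hm : GeneralLinearGroup.map (Int.castRingHom ℚ) m = 1 := by simpa using hmc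
    refine Prod.ext ?_ rfl
    ext i j
    have h1 := congrArg (fun g : GL (Fin 2) ℚ => g.val i j) hm
    have h2 : ((m.val i j : ℤ) : ℚ) = ((1 : Matrix (Fin 2) (Fin 2) ℤ) i j : ℤ) := by
      refine h1.trans ?_
      simp [one_apply]
    exact_mod_cast h2
  have hrange : f.range = G := by
    refine le_antisymm ?_ fun g hg => ?_
    · rintro _ ⟨⟨m, c⟩, rfl⟩
      rw [hf]
      exact mul_mem (hG ⟨m, rfl⟩) c.2.1
    · obtain ⟨c, hcG, m, hm⟩ := exists_mem_positiveScalars_mul_mem hG hg (h g hg)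
      refine ⟨(m, ⟨c, hcG⟩⁻¹), ?_⟩
      rw [hf, hm, (scalar_commute c g).eq]
      simp
  exact ⟨(MonoidHom.ofInjective hinj).trans (MulEquiv.subgroupCongr hrange)⟩

lemma isGL2ZTimesFreeAbelian_of_forall_scalar_mul_mem {G : Subgroup (GL (Fin 2) ℚ)} (hfg : G.FG)
    (hG : integralGL2 < G)
    (h : ∀ g ∈ G, ∃ c : ℚˣ, GeneralLinearGroup.scalar (Fin 2) c * g ∈ integralGL2) :
    IsGL2ZTimesFreeAbelian G := by
  obtain ⟨e⟩ := nonempty_prod_positiveScalars_mulEquiv hG.le h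
  have : Group.FG G := (Group.fg_iff_subgroup_fg G).mpr hfg
  have : Group.FG (positiveScalars G) :=
    Group.fg_of_surjective (f := (MonoidHom.snd _ _).comp e.symm.toMonoidHom)
      (Prod.snd_surjective.comp e.symm.surjective)
  have : Module.Finite ℤ (Additive (positiveScalars G)) :=
    Module.Finite.iff_addGroup_fg.mpr inferInstance
  let b := Module.finBasis ℤ (Additive (positiveScalars G))
  let ε : positiveScalars G ≃*
      Multiplicative (Fin (Module.finrank ℤ (Additive (positiveScalars G))) → ℤ) :=
    AddEquiv.toMultiplicativeRight b.equivFun.toAddEquiv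
  refine ⟨_, ?_, ⟨e.symm.trans ((MulEquiv.refl _).prodCongr ε)⟩⟩
  -- In rank 0 the only positive scalar in `G` is 1, so `G` would lie inside `GL(2, ℤ)`.
  by_contra hk
  have hsub : Subsingleton (positiveScalars G) := by
    have := Module.finrank_zero_iff.mp (show Module.finrank ℤ (Additive (positiveScalars G)) = 0
      by omega)
    exact Additive.ofMul.subsingleton
  refine hG.not_ge fun g hg => ?_
  obtain ⟨c, hc, hcg⟩ := exists_mem_positiveScalars_mul_mem hG.le hg (h g hg)
  have hc1 : c = 1 := congrArg Subtype.val (Subsingleton.elim (⟨c, hc⟩ : positiveScalars G) 1)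
  simpa [hc1] using hcg

end

theorem mainTheorem4 (G : Subgroup (Matrix.GeneralLinearGroup (Fin 2) ℚ)) (hfg : G.FG)
    (hlt : integralGL2 < G) :
    Xor (IsGL2ZTimesFreeAbelian G ∧ ¬ ContainsBS G) (ContainsInfiniteIndexExtensionOfBS G) ∧
      (IsGL2ZTimesFreeAbelian G → ¬ ContainsBS G) := by
  have hBS : ContainsInfiniteIndexExtensionOfBS G → ContainsBS G := by
    rintro ⟨q, hq, K, B, hBK, hKG, hB, -⟩
    exact ⟨q, hq, B, hBK.trans hKG, hB⟩
  refine ⟨?_, not_containsBS_of_isGL2ZTimesFreeAbelian⟩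
  by_cases h : ∀ g ∈ G, ∃ c : ℚˣ, Matrix.GeneralLinearGroup.scalar (Fin 2) c * g ∈ integralGL2
  · have h1 := isGL2ZTimesFreeAbelian_of_forall_scalar_mul_mem hfg hlt h
    have h2 := not_containsBS_of_isGL2ZTimesFreeAbelian h1
    exact Or.inl ⟨⟨h1, h2⟩, fun h3 => h2 (hBS h3)⟩
  · push Not at h
    obtain ⟨g, hg, hc⟩ := h
    have h1 := containsInfiniteIndexExtensionOfBS_of_not_scalar_mul_mem hlt.le hg hc
    exact Or.inr ⟨h1, fun h2 => h2.2 (hBS h1)⟩
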